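/- Let $G$ be a finite group, $\mathcal H$ a finite-dimensional complex Hilbert space and $\{U_g\}_{g\in G}$ a unitary, possibly projective, representation of $G$ on $\mathcal H$. Let $\{\rho_j\}_{j\in J}$ be a finite family of density operators with probabilities $p_j$ ($p_j\ge 0$, $\sum_j p_j=1$), and assume the ensemble is invariant under $G$: for every $g\in G$ there is a permutation $\sigma$ of $J$ with $\rho_{\sigma(j)}=U_g\rho_jU_g^\dagger$ and $p_{\sigma(j)}=p_j$ for all $j$ (for pairwise distinct $\rho_j$: the set $\{\rho_j\}$ is invariant and states in the same orbit have the same probability). For a POVM $P=(P_x)_{x\in X}$ on $\mathcal H$ with finite outcome set $X$, put $p_{xj}=p_j\operatorname{Tr}[P_x\rho_j]$ and $q_x=\sum_j p_{xj}$, and let $$I(P)=H(\{p_j\})+H(\{q_x\})-H(\{p_{xj}\}),\qquad H(\{r_k\})=-\sum_k r_k\log r_k \quad (0\log 0=0)$$ be the mutual information. A POVM with outcome set $\mathsf I\times G$ ($\mathsf I$ finite) is called covariant if $P_{(i,hg)}=U_hP_{(i,g)}U_h^\dagger$ for all $i\in\mathsf I$ and $g,h\in G$. (1) Let $\mathcal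 H=\bigoplus_{\mu\in S}\bigoplus_{k=1}^{m_\mu}\mathcal H^\mu_k$ be a decomposition into mutually orthogonal irreducible invariant subspaces, with $S$ finite, where $\mathcal H^\mu_k$ and $\mathcal H^\nu_l$ carry equivalent representations (i.e. are related by a linear isomorphism commuting with all $U_g$) if and only if $\mu=\nu$. Then there are a finite set $\mathsf I$ with $$|\mathsf I|\le\sum_{\mu\in S}m_\mu^2$$ and a covariant POVM $P$ with outcome set $\mathsf I\times G$, all of whose operators $P_{(i,g)}$ have rank one, such that $I(Q)\le I(P)$ for every POVM $Q$ on $\mathcal H$ with finitely many outcomes. (2) If the representation is irreducible, there is such a maximizing covariant rank-one POVM with $|\mathsf I|=1$, i.e. with outcome set $\simeq G$. -/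

import Mathlib

namespace CovariantPOVM

universe u

/-- A unitary, generally projective, representation of `G` on `H`: unitaries `U g` with
`U g U h = c(g, h) U (g h)` for some scalars `c(g, h)` (automatically of modulus one
if `H ≠ 0`). Ordinary unitary representations are the case `c = 1`. -/
structure UnitaryProjRep (G H : Type*) [Group G] [NormedAddCommGroup H]
    [InnerProductSpace ℂ H] where
  toFun : G → H ≃ₗᵢ[ℂ] H
  map_mul : ∀ g h : G, ∃ c : ℂ, ∀ v : H, toFun g (toFun h v) = c • toFun (g * h) v

section

variable {G H : Type*} [Group G] [NormedAddCommGroup H] [InnerProductSpace ℂ H]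

/-- The operator `U_g A U_g†`. -/
def UnitaryProjRep.conj (U : UnitaryProjRep G H) (g : G) (A : H →ₗ[ℂ] H) : H →ₗ[ℂ] H :=
  (U.toFun g).toLinearEquiv.toLinearMap ∘ₗ A ∘ₗ (U.toFun g).symm.toLinearEquiv.toLinearMap

/-- The subspace `W` is invariant under all `U_g`. -/
def UnitaryProjRep.IsInvariant (U : UnitaryProjRep G H) (W : Submodule ℂ H) : Prop :=
  ∀ g : G, ∀ v ∈ W, U.toFun g v ∈ W

/-- `W` is an irreducible invariant subspace: nonzero, invariant, and without invariant
subspaces other than `0` and `W`. -/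
structure UnitaryProjRep.IsIrreducibleOn (U : UnitaryProjRep G H) (W : Submodule ℂ H) :
    Prop where
  ne_bot : W ≠ ⊥
  invariant : U.IsInvariant W
  minimal : ∀ V : Submodule ℂ H, V ≤ W → U.IsInvariant V → V = ⊥ ∨ V = W

/-- The representation on the whole space is irreducible. -/
def UnitaryProjRep.IsIrreducible (U : UnitaryProjRep G H) : Prop :=
  U.IsIrreducibleOn ⊤

/-- Equivalence of the representations carried by two invariant subspaces: there is a linear
isomorphism `W ≃ W'` that commutes with all `U_g`. -/
def UnitaryProjRep.Equivalent (U : UnitaryProjRep G H) (W W' : Submodule ℂ H) : Prop :=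
  ∃ e : W ≃ₗ[ℂ] W', ∀ (g : G) (w w' : W),
    (w' : H) = U.toFun g (w : H) → ((e w' : W') : H) = U.toFun g ((e w : W') : H)

/-- `H = ⨁_μ ⨁_{k < m μ} V μ k` is a decomposition into mutually orthogonal irreducible
invariant subspaces, where `V μ k` and `V ν l` carry equivalent representations exactly when
`μ = ν`; so `m μ` is the multiplicity of the irreducible representation `μ`. -/
structure UnitaryProjRep.IsIrrepDecomposition (U : UnitaryProjRep G H)
    {S : Type*} (m : S → ℕ) (V : (μ : S) → Fin (m μ) → Submodule ℂ H) : Prop where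
  irreducible : ∀ μ k, U.IsIrreducibleOn (V μ k)
  orthogonal : Pairwise fun a b : (Σ μ : S, Fin (m μ)) => V a.1 a.2 ⟂ V b.1 b.2
  span : ⨆ a : (Σ μ : S, Fin (m μ)), V a.1 a.2 = ⊤
  equivalent_iff : ∀ μ ν k l, U.Equivalent (V μ k) (V ν l) ↔ μ = ν

/-- Complete reducibility: such a decomposition exists for every finite-dimensional `H`. -/
theorem UnitaryProjRep.exists_isIrrepDecomposition {G : Type*} {H : Type u} [Group G]
    [NormedAddCommGroup H] [InnerProductSpace ℂ H] [FiniteDimensional ℂ H]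
    (U : UnitaryProjRep G H) :
    ∃ (S : Type u) (_ : Fintype S) (m : S → ℕ) (V : (μ : S) → Fin (m μ) → Submodule ℂ H),
      U.IsIrrepDecomposition m V := by
  classical
  have horth : ∀ W : Submodule ℂ H, U.IsInvariant W → U.IsInvariant Wᗮ := by
    intro W hW g v hv
    rw [Submodule.mem_orthogonal] at hv ⊢
    intro w hw
    have hmap : W.map (U.toFun g).toLinearEquiv.toLinearMap = W := by
      apply Submodule.eq_of_le_of_finrank_eq
      · rintro _ ⟨x, hx, rfl⟩
        exact hW g x hx
      · exact LinearEquiv.finrank_map_eq (U.toFun g).toLinearEquiv W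
    rw [← hmap] at hw
    obtain ⟨w', hw', rfl⟩ := hw
    have := (U.toFun g).inner_map_map w' v
    exact this.trans (hv w' hw')
  have key : ∀ n : ℕ, ∀ W : Submodule ℂ H, U.IsInvariant W → Module.finrank ℂ W = n →
      ∃ s : Finset (Submodule ℂ H), (∀ V ∈ s, U.IsIrreducibleOn V) ∧
        (s : Set (Submodule ℂ H)).Pairwise (fun a b => a ⟂ b) ∧ s.sup id = W := by
    intro n
    induction n using Nat.strong_induction_on with
    | _ n ih =>
      intro W hW hn
      by_cases hb : W = ⊥
      · exact ⟨∅, by simp, by simp, by simp [hb]⟩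
      have hne : {V : Submodule ℂ H | V ≠ ⊥ ∧ V ≤ W ∧ U.IsInvariant V}.Nonempty :=
        ⟨W, hb, le_rfl, hW⟩
      obtain ⟨V, ⟨hV0, hVW, hVi⟩, hmin⟩ :=
        (wellFounded_lt (α := Submodule ℂ H)).has_min _ hne
      have hirr : U.IsIrreducibleOn V := by
        refine ⟨hV0, hVi, fun V' hV' hi => ?_⟩
        by_contra! hc
        exact hmin V' ⟨hc.1, hV'.trans hVW, hi⟩ (lt_of_le_of_ne hV' hc.2)
      have hW'i : U.IsInvariant (Vᗮ ⊓ W) := fun g v hv =>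
        ⟨horth V hVi g v hv.1, hW g v hv.2⟩
      have hlt : Vᗮ ⊓ W < W := by
        refine lt_of_le_of_ne inf_le_right fun h => hV0 ?_
        have h1 : V ≤ Vᗮ := hVW.trans (inf_eq_right.mp h)
        have h2 := V.inf_orthogonal_eq_bot
        rwa [inf_eq_left.mpr h1] at h2
      obtain ⟨s, hs1, hs2, hs3⟩ := ih _ (hn ▸ Submodule.finrank_lt_finrank_of_lt hlt) _ hW'i rfl
      refine ⟨insert V s, ?_, ?_, ?_⟩
      · intro X hX
        rcases Finset.mem_insert.mp hX with rfl | hX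
        · exact hirr
        · exact hs1 X hX
      · rw [Finset.coe_insert]
        refine hs2.insert fun X hX _ => ?_
        have hle : X ≤ Vᗮ := (Finset.le_sup (f := id) hX).trans (hs3.le.trans inf_le_left)
        have h : X ⟂ V := hle
        exact ⟨h.symm, h⟩
      · rw [Finset.sup_insert, hs3]
        exact Submodule.sup_orthogonal_inf_of_hasOrthogonalProjection hVW
  obtain ⟨s, hs1, hs2, hs3⟩ := key _ ⊤ (fun _ _ _ => trivial) rfl
  let r : Setoid s :=
    { r := fun a b => U.Equivalent a.1 b.1
      iseqv :=
        { refl := fun a => ⟨LinearEquiv.refl ℂ _, fun g w w' h => h⟩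
          symm := by
            rintro a b ⟨e, he⟩
            refine ⟨e.symm, fun g x x' hx => ?_⟩
            have h1 := he g (e.symm x) ⟨_, (hs1 a.1 a.2).invariant g _ (e.symm x).2⟩ rfl
            rw [e.apply_symm_apply, ← hx] at h1
            rw [← Subtype.ext h1, e.symm_apply_apply]
          trans := by
            rintro a b c ⟨e, he⟩ ⟨f, hf⟩
            exact ⟨e.trans f, fun g w w' h => hf g _ _ (he g _ _ h)⟩ } }
  let F : Quotient r → Type u := fun q => {x : s // Quotient.mk r x = q}
  let φ : (q : Quotient r) → F q ≃ Fin (Fintype.card (F q)) := fun q => Fintype.equivFin _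
  have hφ : ∀ q k, Quotient.mk r ((φ q).symm k).1 = q := fun q k => ((φ q).symm k).2
  refine ⟨Quotient r, inferInstance, fun q => Fintype.card (F q),
    fun q k => ((φ q).symm k).1.1, ?_, ?_, ?_, ?_⟩
  · exact fun q k => hs1 _ ((φ q).symm k).1.2
  · rintro ⟨q, k⟩ ⟨q', k'⟩ hne
    refine hs2 ((φ q).symm k).1.2 ((φ q').symm k').1.2 fun h => hne ?_
    have h' : ((φ q).symm k).1 = ((φ q').symm k').1 := Subtype.ext h
    have hq : q = q' := by rw [← hφ q k, ← hφ q' k', h']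
    subst hq
    rw [(φ q).symm.injective (Subtype.ext h')]
  · rw [eq_top_iff, ← hs3]
    refine Finset.sup_le fun X hX => ?_
    let q := Quotient.mk r ⟨X, hX⟩
    refine le_trans (le_of_eq ?_)
      (le_iSup (fun a : (Σ q : Quotient r, Fin (Fintype.card (F q))) =>
        ((φ a.1).symm a.2).1.1) ⟨q, φ q ⟨⟨X, hX⟩, rfl⟩⟩)
    simp
  · intro q q' k l
    refine Iff.trans (Quotient.eq (r := r)).symm ?_
    rw [hφ, hφ]

end

section

variable {H : Type*} [NormedAddCommGroup H] [InnerProductSpace ℂ H] [FiniteDimensional ℂ H]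

/-- Density operators: positive semidefinite with trace one. -/
structure IsDensityOperator (ρ : H →ₗ[ℂ] H) : Prop where
  isPositive : ρ.IsPositive
  trace_eq_one : LinearMap.trace ℂ H ρ = 1

/-- A POVM on `H` with finite outcome space `X`, given by the operators `P({x})`. -/
structure POVM (X H : Type*) [Fintype X] [NormedAddCommGroup H] [InnerProductSpace ℂ H]
    [FiniteDimensional ℂ H] where
  op : X → H →ₗ[ℂ] H
  isPositive : ∀ x, (op x).IsPositive
  sum_eq_one : ∑ x, op x = LinearMap.id

/-- Covariance of a POVM with outcome space `I × G`, on which `G` acts by `h (i, g) = (i, h g)`: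
`P(h x) = U_h P(x) U_h†`. -/
def POVM.IsCovariant {I G : Type*} [Fintype I] [Group G] [Fintype G]
    (U : UnitaryProjRep G H) (P : POVM (I × G) H) : Prop :=
  ∀ (h : G) (i : I) (g : G), P.op (i, h * g) = U.conj h (P.op (i, g))

/-- The joint probability `p_j Tr[P_x ρ_j]` of the outcome `x` and the signal state `j`. -/
noncomputable def jointProb {J X : Type*} [Fintype X] (p : J → ℝ) (ρ : J → H →ₗ[ℂ] H)
    (P : POVM X H) (x : X) (j : J) : ℝ :=
  p j * (LinearMap.trace ℂ H (P.op x ∘ₗ ρ j)).re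

/-- The Shannon entropy `∑ - p log p`, with `0 log 0 = 0`. -/
noncomputable def shannonEntropy {X : Type*} [Fintype X] (p : X → ℝ) : ℝ :=
  ∑ x, Real.negMulLog (p x)

/-- The mutual information `H({p_j}) + H({q_x}) - H({p_xj})` between the signal state and the
outcome of the POVM, with `q_x = ∑_j p_xj` the overall probability of the outcome `x`. -/
noncomputable def mutualInfo {J X : Type*} [Fintype J] [Fintype X] (p : J → ℝ)
    (ρ : J → H →ₗ[ℂ] H) (P : POVM X H) : ℝ :=
  shannonEntropy p + shannonEntropy (fun x => ∑ j, jointProb p ρ P x j)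
    - shannonEntropy (fun xj : X × J => jointProb p ρ P xj.1 xj.2)

/-- An ensemble of signal states: density operators `ρ j` with prior probabilities `p j`. -/
structure IsEnsemble {J : Type*} [Fintype J] (p : J → ℝ) (ρ : J → H →ₗ[ℂ] H) : Prop where
  nonneg : ∀ j, 0 ≤ p j
  sum_eq_one : ∑ j, p j = 1
  density : ∀ j, IsDensityOperator (ρ j)

/-- The ensemble is invariant under the group: every `U_g · U_g†` permutes the signal states,
and states in the same orbit have the same probability. If the `ρ j` are pairwise distinct, this
says exactly that the set of the `ρ j` is invariant and that `p` is constant along orbits. -/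
def IsInvariantEnsemble {G J : Type*} [Group G] (U : UnitaryProjRep G H) (p : J → ℝ)
    (ρ : J → H →ₗ[ℂ] H) : Prop :=
  ∀ g : G, ∃ σ : Equiv.Perm J, ∀ j, ρ (σ j) = U.conj g (ρ j) ∧ p (σ j) = p j

end

end CovariantPOVM

/-! The mutual information is `H(p)` plus a sum over outcomes of `outcomeInfo`, a function of the
outcome operator that is homogeneous, subadditive over positive operators (a log-sum inequality,
from `gibbs_inequality`) and invariant under conjugation by `U_g`. Hence splitting operators into
rank-one pieces loses nothing, and replacing each piece by its orbit, divided by `|G|`, changes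
nothing. It remains to choose seed vectors `v_i` whose twirls `∑ g, U_g |v_i⟩⟨v_i| U_g†` sum to the
identity, with objective `|G| ∑ i, outcomeInfo |v_i⟩⟨v_i|`.

The twirls are self-adjoint elements of the commutant. For fixed directions of the seeds, their
weights therefore solve a linear program with at most `dim U.commutant` constraints, and a
Carathéodory argument (`exists_small_support`) leaves at most that many seeds without lowering the
objective. Schur's lemma bounds the dimension by `∑ μ, m μ ^ 2`, and by one in the irreducible case.
For a fixed number of seeds the feasible set is compact (`isCompact_seeds`) and the objective
continuous, so a maximum exists; by the two reductions it dominates every POVM. -/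

namespace CovariantPOVM

/-! ### Subadditivity of the information of one outcome. -/

section Entropy

variable {J : Type*} [Fintype J]

/-- The function `∑ j, a j log (a j / ∑ k, a k)`. -/
noncomputable def relativeInfo (a : J → ℝ) : ℝ :=
  Real.negMulLog (∑ j, a j) - ∑ j, Real.negMulLog (a j)

theorem relativeInfo_smul (t : ℝ) (a : J → ℝ) :
    relativeInfo (fun j => t * a j) = t * relativeInfo a := by
  simp only [relativeInfo, ← Finset.mul_sum, Real.negMulLog_mul, Finset.sum_add_distrib,
    ← Finset.sum_mul]
  ring

theorem relativeInfo_comp_perm (σ : Equiv.Perm J) (a : J → ℝ) :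
    relativeInfo (fun j => a (σ j)) = relativeInfo a := by
  simp only [relativeInfo]
  rw [Equiv.sum_comp σ a, Equiv.sum_comp σ (fun j => Real.negMulLog (a j))]

/-- This is `1 - 1/x ≤ log x` at `x = a C / (A c)`, multiplied by `a`. The bounds on `a` make all
logarithms genuine when `a > 0`. -/
theorem sub_mul_div_le_mul_log {a c A C : ℝ} (ha : 0 ≤ a) (hac : a ≤ c) (haA : a ≤ A)
    (hcC : c ≤ C) :
    a - A * c / C ≤ a * Real.log a - a * Real.log A - a * Real.log c + a * Real.log C := by
  rcases ha.eq_or_lt with rfl | ha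
  · have : 0 ≤ A * c / C := div_nonneg (mul_nonneg haA hac) (hac.trans hcC)
    simpa using this
  · have hc := ha.trans_le hac
    have hA := ha.trans_le haA
    have hC := hc.trans_le hcC
    have h := Real.one_sub_inv_le_log_of_pos (x := a * C / (A * c)) (by positivity)
    rw [Real.log_div (by positivity) (by positivity), Real.log_mul ha.ne' hC.ne',
      Real.log_mul hA.ne' hc.ne'] at h
    have h2 := mul_le_mul_of_nonneg_left h ha.le
    have h3 : a * (1 - (a * C / (A * c))⁻¹) = a - A * c / C := by
      field_simp
    linarith

/-- Nonnegativity of the relative entropy of the normalized `a` with respect to the normalized `c`,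
obtained by summing the pointwise bound. The condition `a ≤ c` forces `a j = 0` wherever `c j = 0`.
-/
theorem gibbs_inequality {a c : J → ℝ} (ha : ∀ j, 0 ≤ a j) (hac : ∀ j, a j ≤ c j) :
    (∑ j, a j * Real.log (c j)) - (∑ j, a j) * Real.log (∑ j, c j) ≤ relativeInfo a := by
  have hc : ∀ j, 0 ≤ c j := fun j => (ha j).trans (hac j)
  have h := Finset.sum_le_sum fun j (_ : j ∈ Finset.univ) =>
    sub_mul_div_le_mul_log (ha j) (hac j)
      (Finset.single_le_sum (fun k _ => ha k) (Finset.mem_univ j))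
      (Finset.single_le_sum (fun k _ => hc k) (Finset.mem_univ j))
  simp only [Finset.sum_sub_distrib, Finset.sum_add_distrib, ← Finset.sum_mul,
    ← Finset.mul_sum, ← Finset.sum_div] at h
  have h0 : (∑ j, a j) * (∑ j, c j) / (∑ j, c j) ≤ ∑ j, a j := by
    by_cases hC : ∑ j, c j = 0
    · rw [hC]; simpa using Finset.sum_nonneg fun j _ => ha j
    · rw [mul_div_cancel_right₀ _ hC]
  simp only [relativeInfo, Real.negMulLog, neg_mul, Finset.sum_neg_distrib]
  linarith

/-- Gibbs' inequality is applied to `a` and to `b` with the same reference `c = a + b`; the two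
left-hand sides then add up to the information of `a + b`. -/
theorem relativeInfo_add_le {a b : J → ℝ} (ha : ∀ j, 0 ≤ a j) (hb : ∀ j, 0 ≤ b j) :
    relativeInfo (fun j => a j + b j) ≤ relativeInfo a + relativeInfo b := by
  have h1 := gibbs_inequality ha (c := fun j => a j + b j) fun j => le_add_of_nonneg_right (hb j)
  have h2 := gibbs_inequality hb (c := fun j => a j + b j) fun j => le_add_of_nonneg_left (ha j)
  refine le_trans (le_of_eq ?_) (add_le_add h1 h2)
  simp only [relativeInfo, Real.negMulLog, neg_mul, Finset.sum_neg_distrib, add_mul,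
    Finset.sum_add_distrib]
  ring

theorem relativeInfo_sum_le {ι : Type*} (s : Finset ι) {a : ι → J → ℝ}
    (ha : ∀ i j, 0 ≤ a i j) :
    relativeInfo (fun j => ∑ i ∈ s, a i j) ≤ ∑ i ∈ s, relativeInfo (a i) := by
  classical
  induction s using Finset.induction_on with
  | empty => simp [relativeInfo]
  | insert i s hi ih =>
    simp only [Finset.sum_insert hi]
    exact (relativeInfo_add_le (ha i) fun j => Finset.sum_nonneg fun k _ => ha k j).trans
      (add_le_add_right ih _)

theorem continuous_relativeInfo : Continuous (relativeInfo (J := J)) := by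
  unfold relativeInfo
  fun_prop

end Entropy

/-! ### Carathéodory reduction for a linear program. -/

section LinearProgram

/-- A feasible point of a linear program can be replaced by one with small support. -/
theorem exists_small_support {ι E : Type*} [AddCommGroup E] [Module ℂ E] {a : ι → E}
    {f τ : ι → ℝ} {D : ℕ}
    (hD : ∀ s : Finset ι, D < s.card → ∃ c : ι → ℝ, (∃ i ∈ s, c i ≠ 0) ∧
      ∑ i ∈ s, (c i : ℂ) • a i = 0)
    (hτ : ∀ (s : Finset ι) (c : ι → ℝ), ∑ i ∈ s, (c i : ℂ) • a i = 0 → ∑ i ∈ s, c i * τ i = 0)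
    (n : ℕ) (s : Finset ι) (hs : s.card = n) (hpos : ∀ i ∈ s, 0 < τ i)
    (w : ι → ℝ) (hw : ∀ i ∈ s, 0 ≤ w i) :
    ∃ (t : Finset ι) (w' : ι → ℝ), t.card ≤ D ∧ (∀ i ∈ t, 0 ≤ w' i) ∧
      ∑ i ∈ t, (w' i : ℂ) • a i = ∑ i ∈ s, (w i : ℂ) • a i ∧
      ∑ i ∈ s, w i * f i ≤ ∑ i ∈ t, w' i * f i := by
  classical
  induction n generalizing s w with
  | zero => exact ⟨s, w, by omega, hw, rfl, le_rfl⟩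
  | succ n ih =>
    by_cases hsD : s.card ≤ D
    · exact ⟨s, w, hsD, hw, rfl, le_rfl⟩
    -- The sign of the relation is chosen so that moving along `c` does not lower the objective.
    obtain ⟨c, hc0, hca, hcf⟩ : ∃ c : ι → ℝ, (∃ i ∈ s, c i ≠ 0) ∧
        ∑ i ∈ s, (c i : ℂ) • a i = 0 ∧ 0 ≤ ∑ i ∈ s, c i * f i := by
      obtain ⟨c, ⟨i, hi, hci⟩, hc⟩ := hD s (not_le.mp hsD)
      rcases le_total 0 (∑ i ∈ s, c i * f i) with h | h
      · exact ⟨c, ⟨i, hi, hci⟩, hc, h⟩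
      · refine ⟨fun i => -c i, ⟨i, hi, neg_ne_zero.mpr hci⟩, ?_, ?_⟩
        · simpa using hc
        · simpa using h
    -- Since `∑ c i * τ i = 0` with all `τ i > 0`, a nonzero `c` must have a negative entry; this
    -- keeps the move along `c` bounded.
    have hneg : (s.filter fun i => c i < 0).Nonempty := by
      by_contra! h
      obtain ⟨i, hi, hci⟩ := hc0
      have hge : ∀ j ∈ s, 0 ≤ c j := fun j hj => by
        by_contra! hj'
        exact Finset.notMem_empty j (h ▸ Finset.mem_filter.mpr ⟨hj, hj'⟩)
      have h0 := (Finset.sum_eq_zero_iff_of_nonneg fun j hj =>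
        mul_nonneg (hge j hj) (hpos j hj).le).mp (hτ s c hca) i hi
      exact (mul_ne_zero hci (hpos i hi).ne') h0
    -- Ratio test: the largest step that keeps all weights nonnegative brings the weight of `k` to
    -- zero.
    obtain ⟨k, hk, hmin⟩ := Finset.exists_min_image _ (fun i => w i / (-c i)) hneg
    obtain ⟨hks, hck⟩ := Finset.mem_filter.mp hk
    have ht : 0 ≤ w k / (-c k) := div_nonneg (hw k hks) (by linarith)
    have hzero : w k + w k / (-c k) * c k = 0 := by
      have := hck.ne
      field_simp
      ring
    have hnn : ∀ i ∈ s, 0 ≤ w i + w k / (-c k) * c i := by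
      intro i hi
      rcases le_or_gt 0 (c i) with h | h
      · have := hw i hi
        positivity
      · have h1 := (le_div_iff₀ (by linarith : 0 < -c i)).mp
          (hmin i (Finset.mem_filter.mpr ⟨hi, h⟩))
        linarith
    obtain ⟨t, w', h1, h2, h3, h4⟩ := ih (s.erase k) (by rw [Finset.card_erase_of_mem hks]; omega)
      (fun i hi => hpos i (Finset.mem_of_mem_erase hi))
      (fun i => w i + w k / (-c k) * c i) (fun i hi => hnn i (Finset.mem_of_mem_erase hi))
    refine ⟨t, w', h1, h2, ?_, ?_⟩
    · rw [h3, Finset.sum_erase]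
      · simp only [Complex.ofReal_add, Complex.ofReal_mul, add_smul, mul_smul,
          Finset.sum_add_distrib, ← Finset.smul_sum, hca, smul_zero, add_zero]
      · simp only [hzero, Complex.ofReal_zero, zero_smul]
    · refine le_trans ?_ h4
      rw [Finset.sum_erase]
      · simp only [add_mul, mul_assoc, Finset.sum_add_distrib, ← Finset.mul_sum]
        have := mul_nonneg ht hcf
        linarith
      · simp only [hzero, zero_mul]

end LinearProgram

end CovariantPOVM

namespace CovariantPOVM

/-! ### Schur's lemma and the dimension of the commutant. -/

section Commutant

variable {G H : Type*} [Group G] [NormedAddCommGroup H] [InnerProductSpace ℂ H]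

/-- The operators that commute with all `U g`. -/
def UnitaryProjRep.commutant (U : UnitaryProjRep G H) : Submodule ℂ (H →ₗ[ℂ] H) where
  carrier := {A | ∀ g v, A (U.toFun g v) = U.toFun g (A v)}
  add_mem' := fun ha hb g v => by simp [ha g v, hb g v]
  zero_mem' := fun g v => by simp
  smul_mem' := fun c A ha g v => by simp [ha g v]

/-- The intertwiners from `W` to `W'`, extended by zero on the orthogonal complement of `W`. -/
def UnitaryProjRep.intertwiners (U : UnitaryProjRep G H) (W W' : Submodule ℂ H) :
    Submodule ℂ (H →ₗ[ℂ] H) where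
  carrier := {A | A ∈ U.commutant ∧ (∀ v, A v ∈ W') ∧ ∀ v ∈ Wᗮ, A v = 0}
  add_mem' := fun ha hb => ⟨add_mem ha.1 hb.1, fun v => add_mem (ha.2.1 v) (hb.2.1 v),
    fun v hv => by simp [ha.2.2 v hv, hb.2.2 v hv]⟩
  zero_mem' := ⟨zero_mem _, fun v => zero_mem _, fun v _ => rfl⟩
  smul_mem' := fun c A ha => ⟨Submodule.smul_mem _ c ha.1,
    fun v => Submodule.smul_mem _ c (ha.2.1 v), fun v hv => by simp [ha.2.2 v hv]⟩

variable [FiniteDimensional ℂ H] {U : UnitaryProjRep G H} {W W' : Submodule ℂ H}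

/-- The kernel meets `W` in a nonzero invariant subspace, hence contains `W`; it contains `Wᗮ` by
definition of `intertwiners`. -/
theorem UnitaryProjRep.IsIrreducibleOn.eq_zero_of_apply_eq_zero (hW : U.IsIrreducibleOn W)
    {A : H →ₗ[ℂ] H} (hA : A ∈ U.intertwiners W W') {x : H} (hx : x ∈ W) (hx0 : x ≠ 0)
    (hAx : A x = 0) : A = 0 := by
  have hker : LinearMap.ker A ⊓ W = W := by
    refine (hW.minimal _ inf_le_right fun g v hv => ⟨?_, hW.invariant g v hv.2⟩).resolve_left
      fun h => hx0 ?_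
    · have hv1 : A v = 0 := hv.1
      simp [hA.1 g v, hv1]
    · have : x ∈ LinearMap.ker A ⊓ W := ⟨hAx, hx⟩
      rwa [h, Submodule.mem_bot] at this
  have htop : LinearMap.ker A = ⊤ := by
    rw [eq_top_iff, ← Submodule.sup_orthogonal_of_hasOrthogonalProjection (K := W)]
    exact sup_le (inf_eq_right.mp hker) fun v hv => hA.2.2 v hv
  exact LinearMap.ker_eq_top.mp htop

theorem UnitaryProjRep.IsIrreducibleOn.exists_equiv (hW : U.IsIrreducibleOn W)
    (hW' : U.IsIrreducibleOn W') {A : H →ₗ[ℂ] H} (hA : A ∈ U.intertwiners W W') (hA0 : A ≠ 0) :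
    ∃ e : W ≃ₗ[ℂ] W', ∀ w : W, (e w : H) = A w := by
  let B : W →ₗ[ℂ] W' := (A.domRestrict W).codRestrict W' fun w => hA.2.1 w
  have hB : ∀ w : W, (B w : H) = A w := fun w => rfl
  have hinj : Function.Injective B := by
    rw [injective_iff_map_eq_zero]
    intro w hw
    by_contra h
    exact hA0 (hW.eq_zero_of_apply_eq_zero hA w.2 (fun h' => h (Subtype.ext h'))
      (by rw [← hB, hw]; rfl))
  have hmap : W.map A = W' := by
    refine (hW'.minimal _ ?_ ?_).resolve_left fun h => ?_
    · rintro _ ⟨w, -, rfl⟩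
      exact hA.2.1 w
    · rintro g _ ⟨w, hw, rfl⟩
      exact ⟨U.toFun g w, hW.invariant g w hw, hA.1 g w⟩
    · obtain ⟨x, hx, hx0⟩ := W.ne_bot_iff.mp hW.ne_bot
      refine hA0 (hW.eq_zero_of_apply_eq_zero hA hx hx0 ?_)
      have : A x ∈ W.map A := ⟨x, hx, rfl⟩
      rwa [h, Submodule.mem_bot] at this
  have hsurj : Function.Surjective B := by
    rintro ⟨y, hy⟩
    rw [← hmap] at hy
    obtain ⟨w, hw, rfl⟩ := hy
    exact ⟨⟨w, hw⟩, rfl⟩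
  exact ⟨LinearEquiv.ofBijective B ⟨hinj, hsurj⟩, fun w => rfl⟩

/-- Schur's lemma for inequivalent irreducible subspaces. -/
theorem UnitaryProjRep.IsIrreducibleOn.intertwiners_eq_bot (hW : U.IsIrreducibleOn W)
    (hW' : U.IsIrreducibleOn W') (h : ¬ U.Equivalent W W') : U.intertwiners W W' = ⊥ := by
  rw [Submodule.eq_bot_iff]
  intro A hA
  by_contra hA0
  obtain ⟨e, he⟩ := hW.exists_equiv hW' hA hA0
  exact h ⟨e, fun g w w' hw => by rw [he, he, hw, hA.1]⟩

/-- Schur's lemma: intertwiners between irreducible subspaces are unique up to scalars. -/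
theorem UnitaryProjRep.IsIrreducibleOn.finrank_intertwiners_le_one (hW : U.IsIrreducibleOn W)
    (hW' : U.IsIrreducibleOn W') : Module.finrank ℂ (U.intertwiners W W') ≤ 1 := by
  by_cases hbot : U.intertwiners W W' = ⊥
  · rw [hbot, finrank_bot]; exact zero_le_one
  obtain ⟨A, hA, hA0⟩ := (Submodule.ne_bot_iff _).mp hbot
  obtain ⟨e, he⟩ := hW.exists_equiv hW' hA hA0
  have : Nontrivial W := Submodule.nontrivial_iff_ne_bot.mpr hW.ne_bot
  refine finrank_le_one ⟨A, hA⟩ ?_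
  rintro ⟨B, hB⟩
  let B' : W →ₗ[ℂ] W' := (B.domRestrict W).codRestrict W' fun w => hB.2.1 w
  -- An eigenvector of `A⁻¹ B` for the eigenvalue `c` is killed by the intertwiner `c • A - B`,
  -- which must then vanish.
  obtain ⟨c, hc⟩ := Module.End.exists_eigenvalue (e.symm.toLinearMap ∘ₗ B')
  obtain ⟨x, hx⟩ := hc.exists_hasEigenvector
  have hx1 : B' x = c • e x := by
    have := congrArg e hx.apply_eq_smul
    simpa using this
  have hx2 : B x = c • A x := by
    have := congrArg (Subtype.val) hx1
    rw [Submodule.coe_smul, he] at this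
    exact this
  have h0 : c • A - B = 0 := hW.eq_zero_of_apply_eq_zero (W' := W')
    (sub_mem (Submodule.smul_mem _ c hA) hB) x.2 (fun h => hx.2 (Subtype.ext h))
    (by simp [hx2])
  exact ⟨c, Subtype.ext (sub_eq_zero.mp h0)⟩

theorem UnitaryProjRep.IsIrreducible.finrank_commutant_le_one (hU : U.IsIrreducible) :
    Module.finrank ℂ U.commutant ≤ 1 := by
  have h : U.commutant = U.intertwiners ⊤ ⊤ :=
    le_antisymm (fun A hA => ⟨hA, fun v => trivial, fun v hv => by
      rw [Submodule.top_orthogonal_eq_bot, Submodule.mem_bot] at hv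
      rw [hv, map_zero]⟩) fun A hA => hA.1
  rw [h]
  exact UnitaryProjRep.IsIrreducibleOn.finrank_intertwiners_le_one hU hU

theorem UnitaryProjRep.IsInvariant.starProjection_apply (hW : U.IsInvariant W) (g : G) (v : H) :
    W.starProjection (U.toFun g v) = U.toFun g (W.starProjection v) := by
  have hmap : W.map (U.toFun g).toLinearEquiv.toLinearMap = W := by
    apply Submodule.eq_of_le_of_finrank_eq
    · rintro _ ⟨x, hx, rfl⟩
      exact hW g x hx
    · exact LinearEquiv.finrank_map_eq (U.toFun g).toLinearEquiv W
  refine Submodule.eq_starProjection_of_mem_of_inner_eq_zero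
    (hW g _ (W.starProjection_apply_mem v)) fun w hw => ?_
  rw [← hmap] at hw
  obtain ⟨w', hw', rfl⟩ := hw
  rw [← map_sub]
  exact ((U.toFun g).inner_map_map _ _).trans (Submodule.starProjection_inner_eq_zero _ _ hw')

theorem finrank_iSup_le {ι E : Type*} [Fintype ι] [AddCommGroup E] [Module ℂ E]
    [FiniteDimensional ℂ E] (p : ι → Submodule ℂ E) :
    Module.finrank ℂ ↥(⨆ i, p i) ≤ ∑ i, Module.finrank ℂ (p i) := by
  classical
  rw [← Finset.sup_univ_eq_iSup]
  induction (Finset.univ : Finset ι) using Finset.induction_on with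
  | empty => simp
  | insert i s hi ih =>
    rw [Finset.sup_insert, Finset.sum_insert hi]
    exact (Submodule.finrank_add_le_finrank_add_finrank _ _).trans (Nat.add_le_add_left ih _)

theorem UnitaryProjRep.IsIrrepDecomposition.sum_starProjection {S : Type*} [Fintype S] {m : S → ℕ}
    {V : (μ : S) → Fin (m μ) → Submodule ℂ H} (hV : U.IsIrrepDecomposition m V) (v : H) :
    ∑ a : (Σ μ : S, Fin (m μ)), (V a.1 a.2).starProjection v = v := by
  classical
  have hv : v ∈ ⨆ a : (Σ μ : S, Fin (m μ)), V a.1 a.2 := hV.span ▸ Submodule.mem_top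
  induction hv using Submodule.iSup_induction' with
  | mem b x hx =>
    rw [Finset.sum_eq_single b, Submodule.starProjection_eq_self_iff.mpr hx]
    · intro a _ hab
      exact (Submodule.starProjection_apply_eq_zero_iff _).mpr ((hV.orthogonal hab).symm hx)
    · simp
  | zero => simp
  | add x y _ _ hx hy => simp only [map_add, Finset.sum_add_distrib, hx, hy]

/-- The projections onto the summands cut an element of the commutant into intertwining blocks.
Blocks between different `μ` vanish, and each of the `m μ ^ 2` blocks within `μ` contributes
dimension at most one. -/
theorem UnitaryProjRep.IsIrrepDecomposition.finrank_commutant_le {S : Type*} [Fintype S]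
    {m : S → ℕ} {V : (μ : S) → Fin (m μ) → Submodule ℂ H} (hV : U.IsIrrepDecomposition m V) :
    Module.finrank ℂ U.commutant ≤ ∑ μ, m μ ^ 2 := by
  let p : (Σ μ : S, Fin (m μ) × Fin (m μ)) → Submodule ℂ (H →ₗ[ℂ] H) :=
    fun t => U.intertwiners (V t.1 t.2.1) (V t.1 t.2.2)
  have hle : U.commutant ≤ ⨆ t, p t := by
    intro A hA
    let E : (Σ μ : S, Fin (m μ)) → H →ₗ[ℂ] H := fun a => (V a.1 a.2).starProjection.toLinearMap
    have hE : ∀ v, ∑ a, E a v = v := hV.sum_starProjection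
    have hsum : A = ∑ a, ∑ b, E b ∘ₗ A ∘ₗ E a := by
      ext v
      simp only [LinearMap.sum_apply, LinearMap.comp_apply, hE]
      rw [← map_sum, hE]
    rw [hsum]
    refine sum_mem fun a _ => sum_mem fun b _ => ?_
    have hmem : E b ∘ₗ A ∘ₗ E a ∈ U.intertwiners (V a.1 a.2) (V b.1 b.2) := by
      refine ⟨fun g v => ?_, fun v => Submodule.starProjection_apply_mem _ _, fun v hv => ?_⟩
      · change (V b.1 b.2).starProjection (A ((V a.1 a.2).starProjection _)) =
          U.toFun g ((V b.1 b.2).starProjection (A ((V a.1 a.2).starProjection v)))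
        rw [(hV.irreducible _ _).invariant.starProjection_apply, hA,
          (hV.irreducible _ _).invariant.starProjection_apply]
      · change (V b.1 b.2).starProjection (A ((V a.1 a.2).starProjection v)) = 0
        rw [(Submodule.starProjection_apply_eq_zero_iff _).mpr hv, map_zero, map_zero]
    obtain ⟨μ, k⟩ := a
    obtain ⟨ν, l⟩ := b
    by_cases hμν : μ = ν
    · subst hμν
      exact (le_iSup p ⟨μ, k, l⟩) hmem
    · rw [(hV.irreducible _ _).intertwiners_eq_bot (hV.irreducible _ _)
        (fun h => hμν ((hV.equivalent_iff _ _ _ _).mp h)), Submodule.mem_bot] at hmem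
      rw [hmem]
      exact zero_mem _
  calc Module.finrank ℂ U.commutant ≤ Module.finrank ℂ ↥(⨆ t, p t) :=
        Submodule.finrank_mono hle
    _ ≤ ∑ t, Module.finrank ℂ (p t) := finrank_iSup_le p
    _ ≤ ∑ t : (Σ μ : S, Fin (m μ) × Fin (m μ)), 1 := Finset.sum_le_sum fun t _ =>
        (hV.irreducible _ _).finrank_intertwiners_le_one (hV.irreducible _ _)
    _ = ∑ μ, m μ ^ 2 := by simp [sq, Fintype.card_sigma]

/-- A dimension count gives a complex relation. Taking adjoints conjugates its coefficients, so
their real and imaginary parts are relations too, and one of these is nontrivial. Real coefficients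
are needed to perturb weights. -/
theorem exists_real_relation {ι : Type*} {C : Submodule ℂ (H →ₗ[ℂ] H)} {a : ι → H →ₗ[ℂ] H}
    (haC : ∀ i, a i ∈ C) (ha : ∀ i, (a i).adjoint = a i) (s : Finset ι)
    (hs : Module.finrank ℂ C < s.card) :
    ∃ c : ι → ℝ, (∃ i ∈ s, c i ≠ 0) ∧ ∑ i ∈ s, (c i : ℂ) • a i = 0 := by
  classical
  have hli : ¬ LinearIndependent ℂ (fun i : s => (⟨a i, haC i⟩ : C)) := fun h => by
    have := h.fintype_card_le_finrank
    rw [Fintype.card_coe] at this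
    omega
  obtain ⟨c', hc', ⟨i, hi⟩, hci⟩ := Fintype.not_linearIndependent_iff.mp hli
  obtain ⟨c, hc⟩ : ∃ c : ι → ℂ, ∀ j : s, c j = c' j :=
    ⟨fun j => if h : j ∈ s then c' ⟨j, h⟩ else 0, fun j => by simp⟩
  have h1 : ∑ j ∈ s, c j • a j = 0 := by
    have := congrArg (C.subtype) hc'
    rw [← Finset.sum_coe_sort]
    simpa [hc] using this
  have h2 : ∑ j ∈ s, (starRingEnd ℂ) (c j) • a j = 0 := by
    have := congrArg LinearMap.adjoint h1
    simpa only [map_sum, map_smulₛₗ, ha, map_zero] using this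
  have hci' : c i ≠ 0 := by rw [hc ⟨i, hi⟩]; exact hci
  by_cases hre : (c i).re = 0
  · have him : (c i).im ≠ 0 := fun h => hci' (Complex.ext hre h)
    refine ⟨fun j => (c j).im, ⟨i, hi, him⟩, ?_⟩
    simp only [Complex.im_eq_sub_conj, div_eq_inv_mul, mul_smul, sub_smul, ← Finset.smul_sum,
      Finset.sum_sub_distrib, h1, h2, sub_zero, smul_zero]
  · refine ⟨fun j => (c j).re, ⟨i, hi, hre⟩, ?_⟩
    simp only [Complex.re_eq_add_conj, div_eq_inv_mul, mul_smul, add_smul, ← Finset.smul_sum,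
      Finset.sum_add_distrib, h1, h2, add_zero, smul_zero]

end Commutant

end CovariantPOVM

namespace CovariantPOVM

/-! ### Rank-one positive operators. -/

section RankOne

variable {H : Type*} [NormedAddCommGroup H] [InnerProductSpace ℂ H]

/-- The operator `|v⟩⟨v|`. -/
noncomputable def ketbra (v : H) : H →ₗ[ℂ] H := (InnerProductSpace.rankOne ℂ v v).toLinearMap

theorem ketbra_apply (v x : H) : ketbra v x = inner ℂ v x • v := rfl

theorem ketbra_zero : ketbra (0 : H) = 0 := by
  ext x
  simp [ketbra_apply]

theorem isPositive_ketbra (v : H) : (ketbra v).IsPositive :=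
  (InnerProductSpace.isPositive_rankOne_self v).toLinearMap

theorem ketbra_smul (t : ℝ) (v : H) : ketbra ((t : ℂ) • v) = ((t ^ 2 : ℝ) : ℂ) • ketbra v := by
  ext x
  simp only [ketbra_apply, LinearMap.smul_apply, inner_smul_left, smul_smul, Complex.conj_ofReal]
  congr 1
  push_cast
  ring

theorem finrank_range_ketbra {v : H} (hv : v ≠ 0) :
    Module.finrank ℂ (LinearMap.range (ketbra v)) = 1 := by
  have h : LinearMap.range (ketbra v) = Submodule.span ℂ {v} := by
    apply le_antisymm
    · rintro _ ⟨x, rfl⟩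
      exact Submodule.smul_mem _ _ (Submodule.mem_span_singleton_self v)
    · rw [Submodule.span_singleton_le_iff_mem]
      refine ⟨(inner ℂ v v)⁻¹ • v, ?_⟩
      rw [ketbra_apply, inner_smul_right, inv_mul_cancel₀ (inner_self_ne_zero.mpr hv), one_smul]
  rw [h, finrank_span_singleton hv]

variable [FiniteDimensional ℂ H]

theorem trace_ketbra_comp (v : H) (B : H →ₗ[ℂ] H) :
    LinearMap.trace ℂ H (ketbra v ∘ₗ B) = inner ℂ v (B v) := by
  have h : B ∘ₗ ketbra v = (InnerProductSpace.rankOne ℂ (B v) v).toLinearMap := by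
    ext x
    simp [ketbra_apply]
  rw [LinearMap.trace_comp_comm', h, InnerProductSpace.trace_rankOne]

theorem trace_ketbra (v : H) : LinearMap.trace ℂ H (ketbra v) = ((‖v‖ ^ 2 : ℝ) : ℂ) := by
  rw [ketbra, InnerProductSpace.trace_rankOne, inner_self_eq_norm_sq_to_K]
  norm_cast

theorem exists_eq_sum_ketbra {A : H →ₗ[ℂ] H} (hA : A.IsPositive) :
    ∃ (n : ℕ) (u : Fin n → H), A = ∑ i, ketbra (u i) := by
  obtain ⟨n, u, hu⟩ := ContinuousLinearMap.isPositive_iff_eq_sum_rankOne.mp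
    ((LinearMap.isPositive_toContinuousLinearMap_iff A).mpr hA)
  refine ⟨n, u, LinearMap.ext fun x => ?_⟩
  have := congrArg (fun T : H →L[ℂ] H => T x) hu
  simpa [ketbra_apply] using this

end RankOne

/-! ### Conjugation by the group and averaging. -/

section Twirl

variable {G H : Type*} [Group G] [NormedAddCommGroup H] [InnerProductSpace ℂ H]

theorem UnitaryProjRep.conj_apply (U : UnitaryProjRep G H) (g : G) (A : H →ₗ[ℂ] H) (v : H) :
    U.conj g A v = U.toFun g (A ((U.toFun g).symm v)) := rfl

theorem UnitaryProjRep.conj_mul (U : UnitaryProjRep G H) (g h : G) (A : H →ₗ[ℂ] H) :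
    U.conj (g * h) A = U.conj g (U.conj h A) := by
  obtain ⟨c, hc⟩ := U.map_mul g h
  ext v
  obtain ⟨w, rfl⟩ := (U.toFun (g * h)).surjective v
  -- Once rewritten, this reads `c • U_h⁻¹ U_g⁻¹ U_{gh} w = w`, which cancels the projective factor
  -- without using that `c` has modulus one.
  have h1 : (U.toFun h).symm ((U.toFun g).symm (U.toFun g (U.toFun h w))) = w := by simp
  rw [hc, map_smul, map_smul] at h1
  simp only [conj_apply, LinearIsometryEquiv.symm_apply_apply, hc]
  conv_lhs => rw [← h1]
  simp only [map_smul]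

theorem UnitaryProjRep.conj_comp (U : UnitaryProjRep G H) (g : G) (A B : H →ₗ[ℂ] H) :
    U.conj g A ∘ₗ U.conj g B = U.conj g (A ∘ₗ B) := by
  ext v
  simp [conj_apply]

theorem UnitaryProjRep.trace_conj (U : UnitaryProjRep G H) (g : G) (A : H →ₗ[ℂ] H) :
    LinearMap.trace ℂ H (U.conj g A) = LinearMap.trace ℂ H A :=
  LinearMap.trace_conj' A (U.toFun g).toLinearEquiv

theorem UnitaryProjRep.isPositive_conj (U : UnitaryProjRep G H) (g : G) {A : H →ₗ[ℂ] H}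
    (hA : A.IsPositive) : (U.conj g A).IsPositive :=
  (LinearMap.isPositive_linearIsometryEquiv_conj_iff (U.toFun g)).mpr hA

theorem UnitaryProjRep.conj_ketbra (U : UnitaryProjRep G H) (g : G) (v : H) :
    U.conj g (ketbra v) = ketbra (U.toFun g v) := by
  ext x
  rw [conj_apply, ketbra_apply, ketbra_apply, map_smul,
    ← (U.toFun g).inner_map_map v, LinearIsometryEquiv.apply_symm_apply]

/-- The map `A ↦ ∑ g, U_g A U_g†`. -/
noncomputable def UnitaryProjRep.twirl [Fintype G] (U : UnitaryProjRep G H) :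
    (H →ₗ[ℂ] H) →ₗ[ℂ] (H →ₗ[ℂ] H) where
  toFun A := ∑ g, U.conj g A
  map_add' A B := by
    rw [← Finset.sum_add_distrib]
    refine Finset.sum_congr rfl fun g _ => ?_
    ext v
    simp [conj_apply]
  map_smul' c A := by
    rw [RingHom.id_apply, Finset.smul_sum]
    refine Finset.sum_congr rfl fun g _ => ?_
    ext v
    simp [conj_apply]

variable [Fintype G] (U : UnitaryProjRep G H)

theorem UnitaryProjRep.twirl_eq_sum (A : H →ₗ[ℂ] H) : U.twirl A = ∑ g, U.conj g A := rfl

theorem UnitaryProjRep.twirl_id : U.twirl LinearMap.id = (Fintype.card G : ℂ) • LinearMap.id := by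
  ext v
  simp [twirl_eq_sum, conj_apply, Nat.cast_smul_eq_nsmul]

theorem UnitaryProjRep.twirl_mem_commutant (A : H →ₗ[ℂ] H) : U.twirl A ∈ U.commutant := by
  intro h v
  have h1 : U.twirl A = ∑ g, U.conj h (U.conj g A) := by
    rw [twirl_eq_sum, ← Equiv.sum_comp (Equiv.mulLeft h)]
    exact Finset.sum_congr rfl fun g _ => U.conj_mul h g A
  conv_lhs => rw [h1]
  simp only [twirl_eq_sum, LinearMap.sum_apply, map_sum]
  refine Finset.sum_congr rfl fun g _ => ?_
  rw [conj_apply _ h, LinearIsometryEquiv.symm_apply_apply]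

theorem UnitaryProjRep.trace_twirl (A : H →ₗ[ℂ] H) :
    LinearMap.trace ℂ H (U.twirl A) = Fintype.card G * LinearMap.trace ℂ H A := by
  simp [twirl_eq_sum, trace_conj]

variable [FiniteDimensional ℂ H]

theorem UnitaryProjRep.adjoint_twirl {A : H →ₗ[ℂ] H} (hA : A.IsPositive) :
    (U.twirl A).adjoint = U.twirl A :=
  (LinearMap.isPositive_sum _ fun g _ => U.isPositive_conj g hA).adjoint_eq

end Twirl

/-! ### Mutual information as a sum over outcomes. -/

section Information

variable {H : Type*} [NormedAddCommGroup H] [InnerProductSpace ℂ H]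
  {J : Type*} [Fintype J] {p : J → ℝ} {ρ : J → H →ₗ[ℂ] H}

/-- The contribution of an outcome with operator `A` to the mutual information. -/
noncomputable def outcomeInfo (p : J → ℝ) (ρ : J → H →ₗ[ℂ] H) (A : H →ₗ[ℂ] H) : ℝ :=
  relativeInfo fun j => p j * (LinearMap.trace ℂ H (A ∘ₗ ρ j)).re

theorem outcomeInfo_smul (t : ℝ) (A : H →ₗ[ℂ] H) :
    outcomeInfo p ρ ((t : ℂ) • A) = t * outcomeInfo p ρ A := by
  rw [outcomeInfo, outcomeInfo, ← relativeInfo_smul]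
  congr 1
  ext j
  rw [LinearMap.smul_comp, map_smul, smul_eq_mul, Complex.re_ofReal_mul]
  ring

theorem outcomeInfo_zero : outcomeInfo p ρ 0 = 0 := by
  simpa using outcomeInfo_smul (p := p) (ρ := ρ) 0 0

/-- By cyclicity of the trace, conjugating the operator amounts to permuting the signal states,
which only relabels the sum over `j`. -/
theorem outcomeInfo_conj {G : Type*} [Group G] {U : UnitaryProjRep G H}
    (hinv : IsInvariantEnsemble U p ρ) (g : G) (A : H →ₗ[ℂ] H) :
    outcomeInfo p ρ (U.conj g A) = outcomeInfo p ρ A := by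
  obtain ⟨σ, hσ⟩ := hinv g
  rw [outcomeInfo, ← relativeInfo_comp_perm σ, outcomeInfo]
  congr 1
  ext j
  rw [(hσ j).1, (hσ j).2, U.conj_comp, U.trace_conj]

variable [FiniteDimensional ℂ H]

theorem mutualInfo_eq {X : Type*} [Fintype X] (P : POVM X H) :
    mutualInfo p ρ P = shannonEntropy p + ∑ x, outcomeInfo p ρ (P.op x) := by
  simp only [mutualInfo, shannonEntropy, outcomeInfo, relativeInfo, jointProb,
    Fintype.sum_prod_type, Finset.sum_sub_distrib]
  ring

theorem outcomeInfo_sum_ketbra_le (hens : IsEnsemble p ρ) {ι : Type*} (s : Finset ι)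
    (v : ι → H) :
    outcomeInfo p ρ (∑ i ∈ s, ketbra (v i)) ≤ ∑ i ∈ s, outcomeInfo p ρ (ketbra (v i)) := by
  refine le_trans (le_of_eq ?_) (relativeInfo_sum_le s fun i j => ?_)
  · rw [outcomeInfo]
    congr 1
    ext j
    rw [← Finset.mul_sum, show (∑ i ∈ s, ketbra (v i)) ∘ₗ ρ j = ∑ i ∈ s, ketbra (v i) ∘ₗ ρ j from
      Finset.sum_mul _ _ _, map_sum, Complex.re_sum]
  · rw [trace_ketbra_comp]
    exact mul_nonneg (hens.nonneg j) ((hens.density j).isPositive.re_inner_nonneg_right (v i))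

theorem continuous_outcomeInfo_ketbra :
    Continuous fun v : H => outcomeInfo p ρ (ketbra v) := by
  unfold outcomeInfo
  refine continuous_relativeInfo.comp (continuous_pi fun j => ?_)
  simp only [trace_ketbra_comp]
  have := (ρ j).continuous_of_finiteDimensional
  fun_prop

end Information

/-- Serves to pad a family of seeds with zero vectors, or to drop them. -/
theorem sum_comp_of_injective {ι κ E M : Type*} [Fintype ι] [Fintype κ] [Zero E] [AddCommMonoid M]
    {e : ι → κ} (he : Function.Injective e) {w : κ → E} (hw : ∀ k ∉ Set.range e, w k = 0)
    {F : E → M} (hF : F 0 = 0) : ∑ i, F (w (e i)) = ∑ k, F (w k) :=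
  Fintype.sum_of_injective e he _ _ (fun k hk => by rw [hw k hk, hF]) fun _ => rfl

/-! ### Covariant POVMs from seed vectors, and the optimum. -/

section Seeds

variable {G H : Type*} [Group G] [Fintype G] [NormedAddCommGroup H] [InnerProductSpace ℂ H]
  [FiniteDimensional ℂ H] {J : Type*} [Fintype J] {p : J → ℝ} {ρ : J → H →ₗ[ℂ] H}
  {U : UnitaryProjRep G H}

/-- The covariant POVM with operators `U_g |v_i⟩⟨v_i| U_g†`. -/
noncomputable def POVM.ofSeeds (U : UnitaryProjRep G H) {I : Type*} [Fintype I] (v : I → H)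
    (hv : ∑ i, U.twirl (ketbra (v i)) = LinearMap.id) : POVM (I × G) H where
  op x := U.conj x.2 (ketbra (v x.1))
  isPositive x := U.isPositive_conj x.2 (isPositive_ketbra _)
  sum_eq_one := by rw [Fintype.sum_prod_type]; exact hv

theorem mutualInfo_ofSeeds (hinv : IsInvariantEnsemble U p ρ) {I : Type*} [Fintype I] (v : I → H)
    (hv : ∑ i, U.twirl (ketbra (v i)) = LinearMap.id) :
    mutualInfo p ρ (POVM.ofSeeds U v hv) =
      shannonEntropy p + Fintype.card G * ∑ i, outcomeInfo p ρ (ketbra (v i)) := by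
  simp [mutualInfo_eq, POVM.ofSeeds, outcomeInfo_conj hinv, Fintype.sum_prod_type,
    Finset.mul_sum]

/-- Refining into rank-one operators and averaging over the group do not decrease the mutual
information. -/
theorem exists_seeds_ge (hens : IsEnsemble p ρ) {Y : Type*} [Fintype Y] (Q : POVM Y H) :
    ∃ (n : Y → ℕ) (v : (Σ y, Fin (n y)) → H), ∑ i, U.twirl (ketbra (v i)) = LinearMap.id ∧
      mutualInfo p ρ Q ≤
        shannonEntropy p + Fintype.card G * ∑ i, outcomeInfo p ρ (ketbra (v i)) := by
  choose n u hu using fun y => exists_eq_sum_ketbra (Q.isPositive y)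
  have hG : (0 : ℝ) < Fintype.card G := by exact_mod_cast Fintype.card_pos
  have hs : (√(Fintype.card G : ℝ)⁻¹) ^ 2 = (Fintype.card G : ℝ)⁻¹ :=
    Real.sq_sqrt (inv_nonneg.mpr hG.le)
  -- The factor `1/√|G|` compensates for the twirl being an unnormalized sum over `G`.
  refine ⟨n, fun i => ((√(Fintype.card G : ℝ)⁻¹ : ℝ) : ℂ) • u i.1 i.2, ?_, ?_⟩
  · simp only [ketbra_smul, hs, map_smul, ← Finset.smul_sum, ← map_sum]
    rw [Fintype.sum_sigma]
    simp only [← hu, Q.sum_eq_one, U.twirl_id, smul_smul]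
    rw [Complex.ofReal_inv, Complex.ofReal_natCast, inv_mul_cancel₀, one_smul]
    exact_mod_cast hG.ne'
  · rw [mutualInfo_eq]
    simp only [ketbra_smul, hs, outcomeInfo_smul, ← Finset.mul_sum]
    rw [mul_inv_cancel_left₀ hG.ne', Fintype.sum_sigma]
    gcongr with y
    conv_lhs => rw [hu y]
    exact outcomeInfo_sum_ketbra_le hens _ _

/-- The number of seeds can be reduced to the dimension of the commutant. -/
theorem exists_few_seeds_ge {D : ℕ} (hD : Module.finrank ℂ U.commutant ≤ D) {I : Type*} [Fintype I]
    (v : I → H) (hv : ∑ i, U.twirl (ketbra (v i)) = LinearMap.id) :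
    ∃ w : Fin D → H, ∑ i, U.twirl (ketbra (w i)) = LinearMap.id ∧
      ∑ i, outcomeInfo p ρ (ketbra (v i)) ≤ ∑ i, outcomeInfo p ρ (ketbra (w i)) := by
  classical
  -- Zero seeds are discarded so that `τ i = |G| ‖v i‖ ^ 2`, the trace of the twirl, is positive.
  let s : Finset I := Finset.univ.filter fun i => v i ≠ 0
  obtain ⟨t, c, htD, hc, hca, hcf⟩ := exists_small_support
    (a := fun i => U.twirl (ketbra (v i))) (f := fun i => outcomeInfo p ρ (ketbra (v i)))
    (τ := fun i => Fintype.card G * ‖v i‖ ^ 2) (D := D)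
    (fun s' hs' => exists_real_relation (C := U.commutant) (fun i => U.twirl_mem_commutant _)
      (fun i => U.adjoint_twirl (isPositive_ketbra _)) s' (hD.trans_lt hs'))
    (fun s' c h => by
      have h1 := congrArg (LinearMap.trace ℂ H) h
      simp only [map_sum, map_smul, U.trace_twirl, trace_ketbra, map_zero, smul_eq_mul] at h1
      exact_mod_cast h1)
    s.card s rfl
    (fun i hi => by
      have : v i ≠ 0 := by simpa [s] using hi
      positivity)
    (fun _ => 1) (fun _ _ => zero_le_one)
  simp only [Complex.ofReal_one, one_smul, one_mul] at hca hcf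
  rw [Finset.sum_filter_of_ne (p := fun i => v i ≠ 0) fun i _ h h0 =>
    h (by rw [h0, ketbra_zero, map_zero]), hv] at hca
  rw [Finset.sum_filter_of_ne (p := fun i => v i ≠ 0) fun i _ h h0 =>
    h (by rw [h0, ketbra_zero, outcomeInfo_zero])] at hcf
  obtain ⟨e⟩ : Nonempty (t ↪ Fin D) :=
    Function.Embedding.nonempty_of_card_le (by simpa using htD)
  -- The new weights are absorbed into the seeds as square roots; zero vectors then fill up to
  -- exactly `D` seeds, so that the optimization runs over one fixed space.
  let w' : t → H := fun i => ((√(c i) : ℝ) : ℂ) • v i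
  let w : Fin D → H := Function.extend e w' 0
  have hk : ∀ i : t, ketbra (w' i) = (c i : ℂ) • ketbra (v i) := fun i => by
    rw [ketbra_smul, Real.sq_sqrt (hc i i.2)]
  have hw0 : ∀ k ∉ Set.range e, w k = 0 := fun k hk => Function.extend_apply' _ _ _ hk
  have hwe : ∀ i, w (e i) = w' i := e.injective.extend_apply _ _
  refine ⟨w, ?_, ?_⟩
  · rw [← sum_comp_of_injective e.injective hw0 (F := fun x => U.twirl (ketbra x))
      (by rw [ketbra_zero, map_zero]), ← hca]
    simp only [hwe, hk, map_smul]
    exact Finset.sum_coe_sort t fun i => (c i : ℂ) • U.twirl (ketbra (v i))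
  · rw [← sum_comp_of_injective e.injective hw0 (F := fun x => outcomeInfo p ρ (ketbra x))
      (by rw [ketbra_zero, outcomeInfo_zero])]
    simp only [hwe, hk, outcomeInfo_smul]
    exact hcf.trans_eq
      (Finset.sum_coe_sort t fun i => c i * outcomeInfo p ρ (ketbra (v i))).symm

/-- The constraint is closed, being a continuous equation for each test vector. Its trace reads `|G|
∑ i, ‖w i‖ ^ 2 = dim H`, which bounds the seeds. -/
theorem isCompact_seeds (U : UnitaryProjRep G H) (D : ℕ) :
    IsCompact {w : Fin D → H | ∑ i, U.twirl (ketbra (w i)) = LinearMap.id} := by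
  have : ProperSpace H := FiniteDimensional.proper ℂ H
  refine Metric.isCompact_of_isClosed_isBounded ?_ ?_
  · have h : {w : Fin D → H | ∑ i, U.twirl (ketbra (w i)) = LinearMap.id} =
        ⋂ x : H, {w | ∑ i, ∑ g, (inner ℂ (U.toFun g (w i)) x : ℂ) • U.toFun g (w i) = x} := by
      ext w
      simp only [Set.mem_ofPred_eq, Set.mem_iInter, LinearMap.ext_iff, LinearMap.sum_apply,
        U.twirl_eq_sum, U.conj_ketbra, ketbra_apply, LinearMap.id_apply]
    rw [h]
    refine isClosed_iInter fun x => isClosed_eq ?_ continuous_const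
    have hU : ∀ (g : G) (i : Fin D), Continuous fun w : Fin D → H => U.toFun g (w i) :=
      fun g i => (U.toFun g).continuous.comp (continuous_apply i)
    fun_prop
  · refine (Metric.isBounded_closedBall (x := (0 : Fin D → H))
      (r := √(Module.finrank ℂ H))).subset fun w hw => ?_
    rw [mem_closedBall_zero_iff, pi_norm_le_iff_of_nonneg (Real.sqrt_nonneg _)]
    intro i
    apply Real.le_sqrt_of_sq_le
    have h1 := congrArg (LinearMap.trace ℂ H) hw
    simp only [map_sum, U.trace_twirl, trace_ketbra, LinearMap.trace_id] at h1
    have h2 : ∑ i, (Fintype.card G : ℝ) * ‖w i‖ ^ 2 = Module.finrank ℂ H := by exact_mod_cast h1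
    rw [← h2]
    have hG : (1 : ℝ) ≤ Fintype.card G := by exact_mod_cast Fintype.card_pos (α := G)
    calc ‖w i‖ ^ 2 ≤ Fintype.card G * ‖w i‖ ^ 2 := le_mul_of_one_le_left (sq_nonneg _) hG
      _ ≤ _ := Finset.single_le_sum (f := fun i => (Fintype.card G : ℝ) * ‖w i‖ ^ 2)
        (fun j _ => by positivity) (Finset.mem_univ i)

/-- A maximizing covariant rank-one POVM with at most `dim U.commutant` seeds. -/
theorem exists_optimal_povm (hens : IsEnsemble p ρ) (hinv : IsInvariantEnsemble U p ρ) {D : ℕ}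
    (hD : Module.finrank ℂ U.commutant ≤ D) :
    ∃ n : ℕ, n ≤ D ∧ ∃ P : POVM (Fin n × G) H, P.IsCovariant U ∧
      (∀ x, Module.finrank ℂ (LinearMap.range (P.op x)) = 1) ∧
      ∀ (Y : Type*) [Fintype Y] (Q : POVM Y H), mutualInfo p ρ Q ≤ mutualInfo p ρ P := by
  classical
  have hne : {w : Fin D → H | ∑ i, U.twirl (ketbra (w i)) = LinearMap.id}.Nonempty := by
    let Q : POVM Unit H := ⟨fun _ => LinearMap.id, fun _ => LinearMap.isPositive_id, by simp⟩
    obtain ⟨n, v, hv, -⟩ := exists_seeds_ge (U := U) hens Q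
    obtain ⟨w, hw, -⟩ := exists_few_seeds_ge (p := p) (ρ := ρ) hD v hv
    exact ⟨w, hw⟩
  obtain ⟨w, hw, hmax⟩ := (isCompact_seeds U D).exists_isMaxOn hne
    (f := fun w => ∑ i, outcomeInfo p ρ (ketbra (w i)))
    (continuous_finsetSum _ fun i _ =>
      continuous_outcomeInfo_ketbra.comp (continuous_apply i)).continuousOn
  -- The maximizer may contain zero seeds; they are removed because every operator must have rank
  -- exactly one.
  let e := Fintype.equivFin {i // w i ≠ 0}
  let w' : Fin (Fintype.card {i // w i ≠ 0}) → H := fun k => w (e.symm k).1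
  have he : Function.Injective fun k => (e.symm k).1 :=
    Subtype.val_injective.comp e.symm.injective
  have he0 : ∀ i ∉ Set.range fun k => (e.symm k).1, w i = 0 := fun i hi => by
    by_contra h
    exact hi ⟨e ⟨i, h⟩, by simp⟩
  have hw' : ∑ k, U.twirl (ketbra (w' k)) = LinearMap.id := by
    exact (sum_comp_of_injective he he0 (F := fun x => U.twirl (ketbra x))
      (by rw [ketbra_zero, map_zero])).trans hw
  refine ⟨_, (Fintype.card_subtype_le _).trans_eq (Fintype.card_fin D),
    POVM.ofSeeds U w' hw', fun h i g => U.conj_mul h g _, fun x => ?_, fun Y _ Q => ?_⟩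
  · change Module.finrank ℂ (LinearMap.range (U.conj x.2 (ketbra (w' x.1)))) = 1
    rw [U.conj_ketbra]
    refine finrank_range_ketbra fun h => (e.symm x.1).2 ?_
    exact (map_eq_zero_iff _ (U.toFun x.2).injective).mp h
  · obtain ⟨n, v, hv, hQ⟩ := exists_seeds_ge (U := U) hens Q
    obtain ⟨u, hu, hle⟩ := exists_few_seeds_ge (p := p) (ρ := ρ) hD v hv
    rw [mutualInfo_ofSeeds hinv, sum_comp_of_injective he he0
      (F := fun x => outcomeInfo p ρ (ketbra x)) (by rw [ketbra_zero, outcomeInfo_zero])]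
    refine hQ.trans ?_
    gcongr
    exact hle.trans (hmax hu)

end Seeds

end CovariantPOVM

theorem mainTheorem8 {G : Type*} [Group G] [Fintype G]
    {H : Type*} [NormedAddCommGroup H] [InnerProductSpace ℂ H] [FiniteDimensional ℂ H]
    (U : CovariantPOVM.UnitaryProjRep G H)
    {J : Type*} [Fintype J] (p : J → ℝ) (ρ : J → H →ₗ[ℂ] H)
    (hens : CovariantPOVM.IsEnsemble p ρ)
    (hinv : CovariantPOVM.IsInvariantEnsemble U p ρ) :
    (∀ (S : Type*) [Fintype S] (m : S → ℕ) (V : (μ : S) → Fin (m μ) → Submodule ℂ H),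
      U.IsIrrepDecomposition m V →
        ∃ n : ℕ, n ≤ ∑ μ, m μ ^ 2 ∧
          ∃ P : CovariantPOVM.POVM (Fin n × G) H,
            P.IsCovariant U ∧
            (∀ x, Module.finrank ℂ (LinearMap.range (P.op x)) = 1) ∧
            ∀ (Y : Type*) [Fintype Y] (Q : CovariantPOVM.POVM Y H),
              CovariantPOVM.mutualInfo p ρ Q ≤ CovariantPOVM.mutualInfo p ρ P) ∧
    (U.IsIrreducible →
        ∃ P : CovariantPOVM.POVM (Fin 1 × G) H,
          P.IsCovariant U ∧
          (∀ x, Module.finrank ℂ (LinearMap.range (P.op x)) = 1) ∧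
          ∀ (Y : Type*) [Fintype Y] (Q : CovariantPOVM.POVM Y H),
            CovariantPOVM.mutualInfo p ρ Q ≤ CovariantPOVM.mutualInfo p ρ P) := by
  refine ⟨fun S _ m V hV => CovariantPOVM.exists_optimal_povm hens hinv hV.finrank_commutant_le,
    fun hU => ?_⟩
  obtain ⟨n, hn, P, hP⟩ := CovariantPOVM.exists_optimal_povm hens hinv hU.finrank_commutant_le_one
  interval_cases n
  -- Without seeds the identity would be an empty sum, so `H = 0`, which carries no operator of
  -- trace one.
  · exfalso
    have h0 : (LinearMap.id : H →ₗ[ℂ] H) = 0 := by rw [← P.sum_eq_one]; simp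
    obtain ⟨j⟩ : Nonempty J := by
      by_contra h
      rw [not_nonempty_iff] at h
      simpa using hens.sum_eq_one
    have h1 := (hens.density j).trace_eq_one
    rw [← LinearMap.id_comp (ρ j), h0, LinearMap.zero_comp, map_zero] at h1
    exact zero_ne_one h1
  · exact ⟨P, hP⟩
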